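/- There are an algorithm $A$ and a constant $C<\infty$ such that the following holds for every $p\in[2/3,1]$. Neither $A$ nor $C$ depends on $p$, and $p$ is not given to $A$. The algorithm is a computable procedure that may, at each step, request a fresh trial from $\mathrm{Bern}(p)$, flip a fair coin of its own, or halt and return a bit; all trials and all fair coin flips are jointly independent. Then the bit returned by $A$ is distributed exactly as $\mathrm{Bern}(1/(2p))$, that is, $A$ returns $1$ with probability $\frac{1}{2p}$ and $0$ with probability $1-\frac{1}{2p}$ (so it halts almost surely), and the expected number of trials from $\mathrm{Bern}(p)$ that $A$ performs is at most $C$. -/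

import Mathlib

open MeasureTheory ProbabilityTheory
open scoped ENNReal NNReal

/-- What an algorithm with access to a coin of unknown bias does in a given state: it requests a
fresh trial of the unknown coin, or it flips a fair coin of its own, or it halts and returns a
bit. -/
inductive CoinAction where
  | trial : CoinAction
  | flip : CoinAction
  | ret : Bool → CoinAction

/-- The actions form a four-element type; this is an explicit coding of it. -/
def CoinAction.equivSum : CoinAction ≃ Bool ⊕ Bool where
  toFun
    | .trial => Sum.inl true
    | .flip => Sum.inl false
    | .ret b => Sum.inr b
  invFun
    | Sum.inl true => .trial
    | Sum.inl false => .flip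
    | Sum.inr b => .ret b
  left_inv a := by cases a <;> rfl
  right_inv s := by rcases s with (_ | _) | _ <;> rfl

instance CoinAction.instPrimcodable : Primcodable CoinAction :=
  Primcodable.ofEquiv (Bool ⊕ Bool) CoinAction.equivSum

/-- A randomized algorithm with access to independent trials of a coin of unknown bias: a machine
whose states are coded by natural numbers, with a computable choice of the action to take in each
state, and a computable rule for the next state, given the current state and the answer (a bit) to
the request that was made in it. The bias of the coin does not enter. -/
structure CoinAlgorithm where
  State : Type
  [primcodable : Primcodable State]
  init : State
  action : State → CoinAction
  next : State → Bool → State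
  computable_action : Computable action
  computable_next : Computable₂ next

namespace CoinAlgorithm

/-- A configuration: the state, the number of trials of the unknown coin performed so far, and the
number of fair coins flipped so far. -/
structure Config (A : CoinAlgorithm) where
  state : A.State
  trials : ℕ
  flips : ℕ

/-- One step, when `x` lists the results of the trials of the unknown coin and `u` those of the
fair coin flips, each in the order in which they are requested. A halting state is kept forever. -/
def step (A : CoinAlgorithm) (x u : ℕ → Bool) (c : A.Config) : A.Config :=
  match A.action c.state with
  | .trial => ⟨A.next c.state (x c.trials), c.trials + 1, c.flips⟩
  | .flip => ⟨A.next c.state (u c.flips), c.trials, c.flips + 1⟩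
  | .ret _ => c

/-- The configuration after `t` steps. -/
def run (A : CoinAlgorithm) (x u : ℕ → Bool) (t : ℕ) : A.Config :=
  (A.step x u)^[t] ⟨A.init, 0, 0⟩

/-- The algorithm halts and returns the bit `b`. -/
def Returns (A : CoinAlgorithm) (x u : ℕ → Bool) (b : Bool) : Prop :=
  ∃ t, A.action (A.run x u t).state = .ret b

/-- The total number of trials of the unknown coin that the algorithm performs (`⊤` if it performs
infinitely many). -/
noncomputable def numTrials (A : CoinAlgorithm) (x u : ℕ → Bool) : ℕ∞ :=
  ⨆ t, ((A.run x u t).trials : ℕ∞)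

end CoinAlgorithm

/-- `X 0, X 1, …` are trials from `Bern(p)` and `U 0, U 1, …` are fair coin flips, and all of these
are jointly independent. -/
structure IsCoinSource {Ω : Type*} [MeasurableSpace Ω] (P : Measure Ω) (p : ℝ)
    (X U : ℕ → Ω → Bool) : Prop where
  measurable_trial : ∀ i, Measurable (X i)
  measurable_flip : ∀ i, Measurable (U i)
  prob_trial : ∀ i, P {ω | X i ω = true} = ENNReal.ofReal p
  prob_flip : ∀ i, P {ω | U i ω = true} = ENNReal.ofReal (1 / 2)
  indep : iIndepFun (fun i : ℕ ⊕ ℕ => (Sum.elim X U i : Ω → Bool)) P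

/-! Since `1 / (2 * p) = (1 + r) / 2` with `r = (1 - p) / p`, a fair coin flip reduces the task to
simulating a coin of bias `r`, which is the probability that the walk from `1`, going up after a
success and down after a failure, ever reaches `0`. As the walk drifts upwards, it has to be
stopped when it becomes unlikely to come back, and this without knowing `r`.

Ignoring a step up with a suitable probability replaces `r` by `r_N = r (m + 1) N / (m (N + 2))`,
so that `r_(2 m) = r`, the numbers `r_N` increase to `r (m + 1) / m`, which is at most `1` for
large `m`, and `r_N / r_(N + 1) < 1` does not depend on `p`. When the walk with ratio `r_N`
reaches `N + 1`, it goes on with ratio `r_(N + 1)` with probability `(r_N / r_(N + 1)) ^ (N + 1)`,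
and is given up otherwise. Hence `r_N ^ n`, with `n` the present site, is a martingale. Each level
is abandoned with a probability of about `2 / N`, which makes a linear function of `N` and `n`
decrease on average by at least `1` in every step and so bounds the expected running time. -/

theorem IsCoinSource.isProbabilityMeasure {Ω : Type*} [MeasurableSpace Ω] {P : Measure Ω} {p : ℝ}
    {X U : ℕ → Ω → Bool} (h : IsCoinSource P p X U) : IsProbabilityMeasure P :=
  h.indep.isProbabilityMeasure

theorem IsCoinSource.le_one {Ω : Type*} [MeasurableSpace Ω] {P : Measure Ω} {p : ℝ}
    {X U : ℕ → Ω → Bool} (h : IsCoinSource P p X U) : p ≤ 1 := by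
  have := h.isProbabilityMeasure
  have hle : ENNReal.ofReal p ≤ 1 := h.prob_trial 0 ▸ prob_le_one
  exact ENNReal.ofReal_le_one.1 hle

theorem IsCoinSource.measurable {Ω : Type*} [MeasurableSpace Ω] {P : Measure Ω} {p : ℝ}
    {X U : ℕ → Ω → Bool} (h : IsCoinSource P p X U) (i : ℕ ⊕ ℕ) :
    Measurable (Sum.elim X U i : Ω → Bool) := by
  cases i with
  | inl i => exact h.measurable_trial i
  | inr i => exact h.measurable_flip i

theorem setLIntegral_bool_of_indep {Ω : Type*} [MeasurableSpace Ω] {P : Measure Ω}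
    [IsProbabilityMeasure P] {E : Set Ω} {Z : Ω → Bool} (hZ : Measurable Z)
    (hind : ∀ b, P (E ∩ Z ⁻¹' {b}) = P E * P (Z ⁻¹' {b})) {r : ℝ} (hr : 0 ≤ r) (hr1 : r ≤ 1)
    (hZr : P {ω | Z ω = true} = ENNReal.ofReal r) {g : Bool → ℝ} (hg : ∀ b, 0 ≤ g b) :
    ∫⁻ ω in E, ENNReal.ofReal (g (Z ω)) ∂P =
      P E * ENNReal.ofReal (r * g true + (1 - r) * g false) := by
  have hmap (b : Bool) : (P.restrict E).map Z {b} = P E * P (Z ⁻¹' {b}) := by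
    rw [Measure.map_apply hZ .of_discrete, Measure.restrict_apply (hZ .of_discrete),
      Set.inter_comm, hind]
  have htrue : P (Z ⁻¹' {true}) = ENNReal.ofReal r := hZr
  have hfalse : P (Z ⁻¹' {false}) = ENNReal.ofReal (1 - r) := by
    have hcompl : Z ⁻¹' {false} = (Z ⁻¹' {true})ᶜ := by ext; simp
    rw [hcompl, prob_compl_eq_one_sub (hZ .of_discrete), htrue, ENNReal.ofReal_sub _ hr,
      ENNReal.ofReal_one]
  have hr1' := sub_nonneg.2 hr1
  rw [← lintegral_map (f := fun b => ENNReal.ofReal (g b)) .of_discrete hZ, lintegral_fintype,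
    Fintype.sum_bool, hmap, hmap, htrue, hfalse,
    ENNReal.ofReal_add (mul_nonneg hr (hg _)) (mul_nonneg hr1' (hg _)), ENNReal.ofReal_mul hr,
    ENNReal.ofReal_mul hr1']
  ring

namespace CoinAlgorithm

variable {A : CoinAlgorithm}

section Deterministic

variable {x u : ℕ → Bool}

theorem run_succ (x u : ℕ → Bool) (t : ℕ) : A.run x u (t + 1) = A.step x u (A.run x u t) :=
  Function.iterate_succ_apply' _ _ _

theorem trials_le_trials_step (x u : ℕ → Bool) (c : A.Config) :
    c.trials ≤ (A.step x u c).trials := by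
  unfold step
  split <;> simp

theorem flips_le_flips_step (x u : ℕ → Bool) (c : A.Config) :
    c.flips ≤ (A.step x u c).flips := by
  unfold step
  split <;> simp

theorem run_congr {x' u' : ℕ → Bool} {t : ℕ} (hx : ∀ i < (A.run x u t).trials, x i = x' i)
    (hu : ∀ i < (A.run x u t).flips, u i = u' i) : A.run x u t = A.run x' u' t := by
  induction t with
  | zero => rfl
  | succ t ih =>
    rw [run_succ] at hx hu
    have heq := ih (fun i hi => hx i (hi.trans_le (trials_le_trials_step _ _ _)))
      (fun i hi => hu i (hi.trans_le (flips_le_flips_step _ _ _)))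
    rw [run_succ, run_succ, ← heq]
    generalize A.run x u t = c at *
    unfold step at *
    split <;> simp_all

/-- The requests made on the way to the configuration `c`; `Sum.inl i` is the `i`-th trial of the
unknown coin and `Sum.inr i` the `i`-th fair coin flip. -/
def requests (c : A.Config) : Finset (ℕ ⊕ ℕ) :=
  (Finset.range c.trials).disjSum (Finset.range c.flips)

theorem dependsOn_run_eq (t : ℕ) (c : A.Config) :
    DependsOn (fun z : ℕ ⊕ ℕ → Bool => A.run (z ∘ .inl) (z ∘ .inr) t = c) (requests c) := by
  have imp {z z' : ℕ ⊕ ℕ → Bool} (hz : ∀ i ∈ requests c, z i = z' i)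
      (hc : A.run (z ∘ .inl) (z ∘ .inr) t = c) : A.run (z' ∘ .inl) (z' ∘ .inr) t = c := by
    rw [← run_congr _ _, hc] <;> rw [hc] <;> exact fun i hi => hz _ (by simpa [requests] using hi)
  exact fun z z' hz => propext ⟨imp hz, imp fun i hi => (hz i hi).symm⟩

/-- A state in which the algorithm has not halted. -/
def Running (A : CoinAlgorithm) (s : A.State) : Prop :=
  ∀ b, A.action s ≠ .ret b

/-- A property of states that holds initially and is preserved by every transition, so that it
holds in every state the algorithm can reach. -/
structure IsInvariant (A : CoinAlgorithm) (I : A.State → Prop) : Prop where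
  init : I A.init
  next : ∀ s, I s → A.Running s → ∀ b, I (A.next s b)

theorem IsInvariant.run {I : A.State → Prop} (hI : A.IsInvariant I) (x u : ℕ → Bool) (t : ℕ) :
    I (A.run x u t).state := by
  induction t with
  | zero => exact hI.init
  | succ t ih =>
    rw [run_succ]
    generalize A.run x u t = c at *
    unfold step
    split
    · exact hI.next _ ih (by simp [Running, *]) _
    · exact hI.next _ ih (by simp [Running, *]) _
    · exact ih

theorem action_run_of_le {s t : ℕ} {b : Bool} (hst : s ≤ t)
    (h : A.action (A.run x u s).state = .ret b) : A.action (A.run x u t).state = .ret b := by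
  induction t, hst using Nat.le_induction with
  | base => exact h
  | succ t _ ih => simp only [run_succ, step, ih]

/-- The number of steps before the algorithm halts. -/
noncomputable def runtime (A : CoinAlgorithm) (x u : ℕ → Bool) : ℝ≥0∞ :=
  ∑' t, {s | A.Running s}.indicator 1 (A.run x u t).state

theorem trials_run_le (x u : ℕ → Bool) (t : ℕ) :
    ((A.run x u t).trials : ℝ≥0∞) ≤
      ∑ s ∈ Finset.range t, {s | A.Running s}.indicator 1 (A.run x u s).state := by
  induction t with
  | zero => simp [run]
  | succ t ih =>
    rw [Finset.sum_range_succ, run_succ]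
    unfold step
    split
    next hact =>
      rw [Set.indicator_of_mem (show A.Running _ by simp [Running, hact]), Nat.cast_succ]
      exact add_le_add_left ih 1
    all_goals exact ih.trans le_self_add

theorem numTrials_le_runtime (x u : ℕ → Bool) : (A.numTrials x u : ℝ≥0∞) ≤ A.runtime x u := by
  rw [numTrials, ENat.toENNReal_iSup]
  refine iSup_le fun t => ?_
  exact_mod_cast (trials_run_le x u t).trans (ENNReal.sum_le_tsum _)

theorem exists_returns_of_runtime_ne_top (h : A.runtime x u ≠ ⊤) : ∃ b, A.Returns x u b := by
  contrapose! h
  have hrun (t : ℕ) : A.Running (A.run x u t).state := fun b hb => h b ⟨t, hb⟩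
  simp [runtime, Set.indicator, hrun]

/-- The mean of `F` at the next state, for a coin of bias `p`. -/
noncomputable def nextMean (A : CoinAlgorithm) (p : ℝ) (F : A.State → ℝ) (s : A.State) : ℝ :=
  match A.action s with
  | .trial => p * F (A.next s true) + (1 - p) * F (A.next s false)
  | .flip => 1 / 2 * F (A.next s true) + (1 - 1 / 2) * F (A.next s false)
  | .ret _ => F s

theorem nextMean_of_not_running {p : ℝ} {F : A.State → ℝ} {s : A.State} (hs : ¬ A.Running s) :
    A.nextMean p F s = F s := by
  obtain ⟨b, hb⟩ : ∃ b, A.action s = .ret b := by simpa only [Running, not_forall, not_not] using hs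
  simp only [nextMean, hb]

theorem nextMean_one_sub (p : ℝ) (F : A.State → ℝ) (s : A.State) :
    A.nextMean p (1 - F) s = 1 - A.nextMean p F s := by
  unfold nextMean
  split <;> simp only [Pi.sub_apply, Pi.one_apply] <;> ring

theorem IsInvariant.nextMean_nonneg {I : A.State → Prop} (hI : A.IsInvariant I) {p : ℝ}
    (hp : 0 ≤ p) (hp1 : p ≤ 1) {F : A.State → ℝ} (hF : ∀ s, I s → 0 ≤ F s) {s : A.State}
    (hs : I s) : 0 ≤ A.nextMean p F s := by
  have hp1' := sub_nonneg.2 hp1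
  unfold nextMean
  split
  next hact =>
    have hn b := hF _ (hI.next s hs (by simp [Running, hact]) b)
    exact add_nonneg (mul_nonneg hp (hn _)) (mul_nonneg hp1' (hn _))
  next hact =>
    have hn b := hF _ (hI.next s hs (by simp [Running, hact]) b)
    linarith [hn true, hn false]
  · exact hF s hs

end Deterministic

instance : Countable A.Config :=
  have := A.primcodable
  Function.Injective.countable (f := fun c : A.Config => (c.state, c.trials, c.flips))
    (by rintro ⟨⟩ ⟨⟩ h; simp_all)

instance : MeasurableSpace A.Config := ⊤

section Random

variable {Ω : Type*}

/-- The configuration after `t` steps, as a random variable. -/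
def config (A : CoinAlgorithm) (X U : ℕ → Ω → Bool) (t : ℕ) (ω : Ω) : A.Config :=
  A.run (X · ω) (U · ω) t

theorem exists_config_fiber_eq_preimage (X U : ℕ → Ω → Bool) (t : ℕ) (c : A.Config) :
    ∃ B : Set (requests c → Bool),
      A.config X U t ⁻¹' {c} = (fun ω (i : requests c) => (Sum.elim X U i : Ω → Bool) ω) ⁻¹' B := by
  obtain ⟨B, hB⟩ := dependsOn_iff_exists_comp.1 (dependsOn_run_eq (A := A) t c)
  exact ⟨{z | B z}, Set.ext fun ω => iff_of_eq (congrFun hB fun i => Sum.elim X U i ω)⟩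

variable [MeasurableSpace Ω] {P : Measure Ω} {p : ℝ} {X U : ℕ → Ω → Bool}
  {I : A.State → Prop}

theorem measurable_config (h : IsCoinSource P p X U) (t : ℕ) : Measurable (A.config X U t) := by
  refine measurable_to_countable' fun c => ?_
  obtain ⟨B, hB⟩ := exists_config_fiber_eq_preimage (A := A) X U t c
  have hm : Measurable fun ω (i : requests c) => (Sum.elim X U i : Ω → Bool) ω :=
    measurable_pi_lambda _ fun i => h.measurable i
  rw [hB]
  exact hm .of_discrete

theorem measurable_comp_state_config (h : IsCoinSource P p X U) (t : ℕ) (φ : A.State → ℝ≥0∞) :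
    Measurable fun ω => φ (A.config X U t ω).state :=
  measurable_from_top.comp (g := fun c : A.Config => φ c.state) (measurable_config h t)

theorem measurable_runtime (h : IsCoinSource P p X U) :
    Measurable fun ω => A.runtime (X · ω) (U · ω) :=
  .tsum fun t => measurable_comp_state_config h t _

theorem measure_config_inter_request (h : IsCoinSource P p X U) (t : ℕ) (c : A.Config)
    {k : ℕ ⊕ ℕ} (hk : k ∉ requests c) (b : Bool) :
    P (A.config X U t ⁻¹' {c} ∩ Sum.elim X U k ⁻¹' {b}) =
      P (A.config X U t ⁻¹' {c}) * P (Sum.elim X U k ⁻¹' {b}) := by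
  obtain ⟨B, hB⟩ := exists_config_fiber_eq_preimage (A := A) X U t c
  rw [hB]
  exact (h.indep.indepFun_finset (requests c) {k} (by simpa using hk)
    h.measurable).measure_inter_preimage_eq_mul B {z | z ⟨k, by simp⟩ = b} .of_discrete .of_discrete

theorem setLIntegral_step (h : IsCoinSource P p X U) (hp : 0 ≤ p) (t : ℕ) (c : A.Config)
    {F : A.State → ℝ} (hF : A.Running c.state → ∀ b, 0 ≤ F (A.next c.state b)) :
    ∫⁻ ω in A.config X U t ⁻¹' {c}, ENNReal.ofReal (F (A.step (X · ω) (U · ω) c).state) ∂P =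
      P (A.config X U t ⁻¹' {c}) * ENNReal.ofReal (A.nextMean p F c.state) := by
  have := h.isProbabilityMeasure
  unfold step nextMean
  rcases hact : A.action c.state with _ | _ | b
  · exact setLIntegral_bool_of_indep (h.measurable_trial _)
      (measure_config_inter_request h t c (k := .inl c.trials) (by simp [requests]))
      hp h.le_one (h.prob_trial _) (hF (by simp [Running, hact]))
  · exact setLIntegral_bool_of_indep (h.measurable_flip _)
      (measure_config_inter_request h t c (k := .inr c.flips) (by simp [requests]))
      (by norm_num) (by norm_num) (h.prob_flip _) (hF (by simp [Running, hact]))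
  · simp [mul_comm]

theorem lintegral_eq_tsum_config (h : IsCoinSource P p X U) (t : ℕ) (g : Ω → ℝ≥0∞) :
    ∫⁻ ω, g ω ∂P = ∑' c, ∫⁻ ω in A.config X U t ⁻¹' {c}, g ω ∂P := by
  rw [← lintegral_iUnion (fun c => measurable_config h t .of_discrete)
    (fun c d hcd => (Set.disjoint_singleton.2 hcd).preimage _), ← Set.preimage_iUnion,
    Set.iUnion_of_singleton, Set.preimage_univ, Measure.restrict_univ]

theorem lintegral_config_succ (h : IsCoinSource P p X U) (hp : 0 ≤ p) (hI : A.IsInvariant I)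
    {F : A.State → ℝ} (hF : ∀ s, I s → 0 ≤ F s) (t : ℕ) :
    ∫⁻ ω, ENNReal.ofReal (F (A.config X U (t + 1) ω).state) ∂P =
      ∫⁻ ω, ENNReal.ofReal (A.nextMean p F (A.config X U t ω).state) ∂P := by
  rw [lintegral_eq_tsum_config (A := A) h t, lintegral_eq_tsum_config (A := A) h t]
  refine tsum_congr fun c => ?_
  obtain hempty | ⟨ω₀, rfl⟩ := (A.config X U t ⁻¹' {c}).eq_empty_or_nonempty
  · simp only [hempty, setLIntegral_empty]
  have hm := measurable_config (A := A) h t (.of_discrete (s := {A.config X U t ω₀}))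
  trans P (A.config X U t ⁻¹' {A.config X U t ω₀}) *
    ENNReal.ofReal (A.nextMean p F (A.config X U t ω₀).state)
  · rw [← setLIntegral_step h hp t (A.config X U t ω₀)
      fun hs b => hF _ (hI.next _ (hI.run _ _ _) hs b)]
    refine setLIntegral_congr_fun hm fun ω hω => ?_
    simp only [Set.mem_preimage, Set.mem_singleton_iff] at hω
    simp only [← hω]
    simp only [config, run_succ]
  · rw [mul_comm, ← setLIntegral_const]
    refine setLIntegral_congr_fun hm fun ω hω => ?_
    simp only [Set.mem_preimage, Set.mem_singleton_iff] at hω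
    simp only [hω]

theorem lintegral_config_add_sum_le (h : IsCoinSource P p X U) (hp : 0 ≤ p) (hI : A.IsInvariant I)
    {F : A.State → ℝ} (hF : ∀ s, I s → 0 ≤ F s) {κ : A.State → ℝ≥0∞}
    (hκ : ∀ s, I s → ENNReal.ofReal (A.nextMean p F s) + κ s ≤ ENNReal.ofReal (F s)) (t : ℕ) :
    ∫⁻ ω, ENNReal.ofReal (F (A.config X U t ω).state) ∂P +
      ∑ s ∈ Finset.range t, ∫⁻ ω, κ (A.config X U s ω).state ∂P ≤ ENNReal.ofReal (F A.init) := by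
  have := h.isProbabilityMeasure
  induction t with
  | zero => simp [config, run]
  | succ t ih =>
    refine le_trans ?_ ih
    rw [Finset.sum_range_succ, lintegral_config_succ h hp hI hF, add_comm (Finset.sum _ _),
      ← add_assoc, ← lintegral_add_left
        (measurable_comp_state_config h t fun s => ENNReal.ofReal (A.nextMean p F s))]
    gcongr
    exact hκ _ (hI.run _ _ _)

theorem lintegral_runtime_le (h : IsCoinSource P p X U) (hp : 0 ≤ p) (hI : A.IsInvariant I)
    {W : A.State → ℝ} (hW : ∀ s, I s → 0 ≤ W s)
    (hdrift : ∀ s, I s → A.Running s → A.nextMean p W s + 1 ≤ W s) :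
    ∫⁻ ω, A.runtime (X · ω) (U · ω) ∂P ≤ ENNReal.ofReal (W A.init) := by
  change ∫⁻ ω, ∑' t, {s | A.Running s}.indicator 1 (A.config X U t ω).state ∂P ≤ _
  rw [lintegral_tsum fun t => (measurable_comp_state_config h t _).aemeasurable,
    ENNReal.tsum_eq_iSup_nat]
  refine iSup_le fun t =>
    le_add_self.trans (lintegral_config_add_sum_le h hp hI hW (fun s hs => ?_) t)
  by_cases hrun : A.Running s
  · have hmean := hI.nextMean_nonneg hp h.le_one hW hs
    simpa [hrun, ENNReal.ofReal_add hmean] using ENNReal.ofReal_le_ofReal (hdrift s hs hrun)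
  · simp [hrun, nextMean_of_not_running hrun]

theorem measure_returns_le (h : IsCoinSource P p X U) (hp : 0 ≤ p) (hI : A.IsInvariant I)
    {F : A.State → ℝ} (hF : ∀ s, I s → 0 ≤ F s) (hmean : ∀ s, I s → A.nextMean p F s ≤ F s)
    {b : Bool} (hb : ∀ s, I s → A.action s = .ret b → 1 ≤ F s) :
    P {ω | A.Returns (X · ω) (U · ω) b} ≤ ENNReal.ofReal (F A.init) := by
  set E : ℕ → Set Ω := fun t => {ω | A.action (A.config X U t ω).state = .ret b}
  have hE : {ω | A.Returns (X · ω) (U · ω) b} = ⋃ t, E t := by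
    ext ω
    simp [E, Returns, config]
  have hmono : Monotone E := fun s t hst ω hω => action_run_of_le hst hω
  rw [hE, hmono.measure_iUnion]
  refine iSup_le fun t => ?_
  calc P (E t) ≤ P {ω | 1 ≤ ENNReal.ofReal (F (A.config X U t ω).state)} :=
        measure_mono fun ω hω => ENNReal.one_le_ofReal.2 (hb _ (hI.run _ _ _) hω)
    _ ≤ ∫⁻ ω, ENNReal.ofReal (F (A.config X U t ω).state) ∂P := by
        simpa using mul_meas_ge_le_lintegral (measurable_comp_state_config h t fun s =>
          ENNReal.ofReal (F s)) 1
    _ ≤ ENNReal.ofReal (F A.init) := le_self_add.trans <|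
        lintegral_config_add_sum_le (κ := 0) h hp hI hF
          (fun s hs => by simpa using ENNReal.ofReal_le_ofReal (hmean s hs)) t

theorem one_le_measure_returns_add (h : IsCoinSource P p X U)
    (hfin : ∫⁻ ω, A.runtime (X · ω) (U · ω) ∂P ≠ ⊤) :
    1 ≤ P {ω | A.Returns (X · ω) (U · ω) true} + P {ω | A.Returns (X · ω) (U · ω) false} := by
  have := h.isProbabilityMeasure
  have hae : ∀ᵐ ω ∂P, ω ∈ {ω | A.Returns (X · ω) (U · ω) true} ∪
      {ω | A.Returns (X · ω) (U · ω) false} := by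
    filter_upwards [ae_lt_top (measurable_runtime h) hfin] with ω hω
    simpa [or_comm] using exists_returns_of_runtime_ne_top hω.ne
  rw [← measure_univ (μ := P), ← measure_congr (Filter.eventuallyEq_univ.2 hae)]
  exact measure_union_le _ _

/-- Optional stopping: both `V` and `1 - V` bound the probability of the bit they extend, and
these bounds add up to `1`. -/
theorem measure_returns_eq (h : IsCoinSource P p X U) (hp : 0 ≤ p) (hI : A.IsInvariant I)
    (hfin : ∫⁻ ω, A.runtime (X · ω) (U · ω) ∂P ≠ ⊤) {V : A.State → ℝ}
    (hV : ∀ s, I s → V s ∈ Set.Icc 0 1) (hmean : ∀ s, I s → A.nextMean p V s = V s)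
    (hret : ∀ s b, I s → A.action s = .ret b → V s = if b then 1 else 0) :
    P {ω | A.Returns (X · ω) (U · ω) true} = ENNReal.ofReal (V A.init) ∧
      P {ω | A.Returns (X · ω) (U · ω) false} = ENNReal.ofReal (1 - V A.init) := by
  have htrue : P {ω | A.Returns (X · ω) (U · ω) true} ≤ ENNReal.ofReal (V A.init) :=
    measure_returns_le h hp hI (fun s hs => (hV s hs).1) (fun s hs => (hmean s hs).le)
      fun s hs hact => by simp [hret s _ hs hact]
  have hfalse : P {ω | A.Returns (X · ω) (U · ω) false} ≤ ENNReal.ofReal (1 - V A.init) :=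
    measure_returns_le (F := 1 - V) h hp hI (fun s hs => sub_nonneg.2 (hV s hs).2)
      (fun s hs => by simp [nextMean_one_sub, hmean s hs])
      fun s hs hact => by simp [hret s _ hs hact]
  have hone := one_le_measure_returns_add h hfin
  have hsum : ENNReal.ofReal (V A.init) + ENNReal.ofReal (1 - V A.init) = 1 := by
    have hinit := hV _ hI.init
    rw [← ENNReal.ofReal_add hinit.1 (sub_nonneg.2 hinit.2), add_sub_cancel, ENNReal.ofReal_one]
  refine ⟨htrue.antisymm ?_, hfalse.antisymm ?_⟩
  · refine ENNReal.le_of_add_le_add_right (a := ENNReal.ofReal (1 - V A.init))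
      ENNReal.ofReal_ne_top ?_
    exact hsum.le.trans (hone.trans (by gcongr))
  · refine ENNReal.le_of_add_le_add_left (a := ENNReal.ofReal (V A.init))
      ENNReal.ofReal_ne_top ?_
    exact hsum.le.trans (hone.trans (by gcongr))

end Random

end CoinAlgorithm

theorem primrec_sum {α β σ : Type*} [Primcodable α] [Primcodable β] [Primcodable σ]
    {f : α ⊕ β → σ} (hl : Primrec fun a => f (.inl a)) (hr : Primrec fun b => f (.inr b)) :
    Primrec f :=
  (Primrec.sumCasesOn .id (hl.comp .snd).to₂ (hr.comp .snd).to₂).of_eq fun s => by cases s <;> rfl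

theorem primrec₂_sum {α β γ σ : Type*} [Primcodable α] [Primcodable β] [Primcodable γ]
    [Primcodable σ] {f : α ⊕ β → γ → σ} (hl : Primrec₂ fun a c => f (.inl a) c)
    (hr : Primrec₂ fun b c => f (.inr b) c) : Primrec₂ f :=
  (Primrec.sumCasesOn .fst (hl.comp .snd (.comp .snd .fst)).to₂
    (hr.comp .snd (.comp .snd .fst)).to₂).of_eq fun ⟨s, _⟩ => by cases s <;> rfl

namespace ReciprocalHalf

/-- What remains to be done: `inl b` stands for returning the bit `b`, and `inr (N, n)` for
returning `true` with probability `base m p N ^ n`, which is done by running the damped walk of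
level `N` from the site `n` until it reaches `0` or `N + 1`. -/
abbrev Goal := Bool ⊕ ℕ × ℕ

/-- The states of the algorithm: `inl g` pursues the goal `g`, and `inr ((a, b), (g, g'))` chooses
between the goals `g` and `g'`, with probabilities `a / b` and `1 - a / b`, by means of fair coin
flips. -/
abbrev State := Goal ⊕ (ℕ × ℕ) × Goal × Goal

/-- The state in which a goal is taken up. From `inr (N, N + 1)` the walk moves to level `N + 1`
with the probability `base m p N ^ (N + 1) / base m p (N + 1) ^ (N + 1)`, which does not depend on
`p`, and otherwise the algorithm gives up and returns `false`. -/
def arrive : Goal → State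
  | .inl b => .inl (.inl b)
  | .inr (N, n) =>
    if n = 0 then .inl (.inl true)
    else if N < n then
      .inr (((N * (N + 3)) ^ n, ((N + 1) * (N + 2)) ^ n), (.inr (N + 1, n), .inl false))
    else .inl (.inr (N, n))

/-- The goal chosen between `g` and `g'` when the first binary digit of `a / b` decides. -/
def decided (a b : ℕ) (g g' : Goal) : Goal :=
  if b ≤ 2 * a then g else g'

/-- The numerator over `b` that remains of `a / b` when its first binary digit is dropped and the
others are shifted. -/
def remainder (a b : ℕ) : ℕ :=
  if b ≤ 2 * a then 2 * a - b else 2 * a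

/-- The action taken in each state. -/
def action : State → CoinAction
  | .inl (.inl b) => .ret b
  | .inl (.inr _) => .trial
  | .inr _ => .flip

/-- The transitions of the algorithm. The walk of level `N` takes a step up after a success only
with probability `m (N + 2) / ((m + 1) N)`, and a step down after every failure. A larger `m`
serves biases closer to `1 / 2`. -/
def next (m : ℕ) (s : State) (x : Bool) : State :=
  match s with
  | .inl (.inl b) => .inl (.inl b)
  | .inl (.inr (N, n)) =>
    if x then .inr ((m * (N + 2), (m + 1) * N), (.inr (N, n + 1), .inr (N, n)))
    else arrive (.inr (N, n - 1))
  | .inr ((a, b), (g, g')) =>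
    if x then arrive (decided a b g g') else .inr ((remainder a b, b), (g, g'))

section Computability

open Primrec

theorem primrec_arrive : Primrec arrive := by
  have N_add (k : ℕ) : Primrec fun v : ℕ × ℕ => v.1 + k := nat_add.comp fst (.const k)
  have pow : Primrec₂ fun k l : ℕ => k ^ l := Primrec₂.unpaired'.1 Nat.Primrec.pow
  refine primrec_sum (sumInl.comp sumInl) ?_
  exact .ite (Primrec.eq.comp snd (.const 0)) (.const _) <| .ite (nat_lt.comp fst snd)
    (sumInr.comp <| .pair
      (.pair (pow.comp (nat_mul.comp fst (N_add 3)) snd)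
        (pow.comp (nat_mul.comp (N_add 1) (N_add 2)) snd))
      (.pair (sumInr.comp (.pair (N_add 1) snd)) (.const _)))
    (sumInl.comp sumInr)

theorem primrec_action : Primrec action :=
  primrec_sum (primrec_sum (dom_finite _) (.const _)) (.const _)

theorem primrec_next_site (m : ℕ) :
    Primrec₂ fun (v : ℕ × ℕ) (x : Bool) => next m (.inl (.inr v)) x := by
  have N : Primrec fun y : (ℕ × ℕ) × Bool => y.1.1 := fst.comp fst
  have n : Primrec fun y : (ℕ × ℕ) × Bool => y.1.2 := snd.comp fst
  exact .ite (Primrec.eq.comp snd (.const true))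
    (sumInr.comp <| .pair
      (.pair (nat_mul.comp (.const m) (nat_add.comp N (.const 2)))
        (nat_mul.comp (.const (m + 1)) N))
      (.pair (sumInr.comp (.pair N (nat_add.comp n (.const 1)))) (sumInr.comp fst)))
    (primrec_arrive.comp (sumInr.comp (.pair N (nat_sub.comp n (.const 1)))))

theorem primrec_next_choice (m : ℕ) :
    Primrec₂ fun (v : (ℕ × ℕ) × Goal × Goal) (x : Bool) => next m (.inr v) x := by
  have two_mul_a : Primrec fun y : ((ℕ × ℕ) × Goal × Goal) × Bool => 2 * y.1.1.1 :=
    nat_mul.comp (.const 2) (fst.comp (fst.comp fst))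
  have b : Primrec fun y : ((ℕ × ℕ) × Goal × Goal) × Bool => y.1.1.2 := snd.comp (fst.comp fst)
  have goals : Primrec fun y : ((ℕ × ℕ) × Goal × Goal) × Bool => y.1.2 := snd.comp fst
  have digit := nat_le.comp b two_mul_a
  exact .ite (Primrec.eq.comp snd (.const true))
    (primrec_arrive.comp (.ite digit (fst.comp goals) (snd.comp goals)))
    (sumInr.comp (.pair (.pair (.ite digit (nat_sub.comp two_mul_a b) two_mul_a) b) goals))

theorem primrec_next (m : ℕ) : Primrec₂ (next m) :=
  primrec₂_sum (primrec₂_sum (sumInl.comp (sumInl.comp fst)).to₂ (primrec_next_site m))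
    (primrec_next_choice m)

end Computability

/-- The algorithm that returns `true` with probability `1 / (2 * p)`, for all biases `p` such that
`(1 - p) (m + 1) < p m`. It starts by choosing between returning `true` and the walk from `1`. -/
def algorithm (m : ℕ) : CoinAlgorithm where
  State := State
  init := .inr ((1, 2), (.inl true, .inr (2 * m, 1)))
  action := action
  next := next m
  computable_action := primrec_action.to_comp
  computable_next := (primrec_next m).to_comp

/-- The goals that occur. -/
def GoalValid (m : ℕ) : Goal → Prop
  | .inl _ => True
  | .inr (N, n) => 2 * m ≤ N ∧ n ≤ N + 1

/-- The states that occur. -/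
def StateValid (m : ℕ) : State → Prop
  | .inl (.inl _) => True
  | .inl (.inr (N, n)) => 2 * m ≤ N ∧ n ≠ 0 ∧ n ≤ N
  | .inr ((a, b), (g, g')) => b ≠ 0 ∧ a ≤ b ∧ GoalValid m g ∧ GoalValid m g'

theorem stateValid_arrive {m : ℕ} {g : Goal} (hg : GoalValid m g) : StateValid m (arrive g) := by
  rcases g with b | ⟨N, n⟩
  · trivial
  obtain ⟨hN, hnN⟩ := hg
  simp only [arrive]
  split_ifs with h0 hlt
  · trivial
  · have hle : N * (N + 3) ≤ (N + 1) * (N + 2) := by lia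
    exact ⟨by positivity, Nat.pow_le_pow_left hle n, ⟨by lia, by lia⟩, trivial⟩
  · exact ⟨hN, h0, not_lt.1 hlt⟩

theorem remainder_le {a b : ℕ} (hab : a ≤ b) : remainder a b ≤ b := by
  unfold remainder
  split_ifs <;> lia

theorem isInvariant_stateValid {m : ℕ} (hm : 0 < m) : (algorithm m).IsInvariant (StateValid m) where
  init := ⟨two_ne_zero, one_le_two, trivial, le_rfl, by lia⟩
  next s hs _ x := by
    change StateValid m (next m s x)
    rcases s with (_ | ⟨N, n⟩) | ⟨⟨a, b⟩, g, g'⟩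
    · trivial
    · obtain ⟨hN, -, hnN⟩ := hs
      cases x
      · exact stateValid_arrive (g := .inr (N, n - 1)) ⟨hN, by lia⟩
      · exact ⟨(Nat.mul_pos m.succ_pos (by lia)).ne', by lia, ⟨hN, by lia⟩, hN, by lia⟩
    · obtain ⟨hb, hab, hg, hg'⟩ := hs
      cases x
      · exact ⟨hb, remainder_le hab, hg, hg'⟩
      · exact stateValid_arrive (by unfold decided; split_ifs <;> assumption)

/-- The mean of `F` at the goal in which the state results, plus `k` if a choice is pending. -/
noncomputable def stateMean (F : Goal → ℝ) (k : ℝ) : State → ℝ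
  | .inl g => F g
  | .inr ((a, b), (g, g')) => a / b * F g + (1 - a / b) * F g' + k

theorem stateMean_nonneg {m : ℕ} {F : Goal → ℝ} (hF : ∀ g, GoalValid m g → 0 ≤ F g) {k : ℝ}
    (hk : 0 ≤ k) {s : State} (hs : StateValid m s) : 0 ≤ stateMean F k s := by
  rcases s with (b | ⟨N, n⟩) | ⟨⟨a, b⟩, g, g'⟩
  · exact hF _ trivial
  · exact hF (.inr (N, n)) ⟨hs.1, hs.2.2.trans N.le_succ⟩
  · obtain ⟨-, hab, hg, hg'⟩ := hs
    have hle : (a / b : ℝ) ≤ 1 := div_le_one_of_le₀ (mod_cast hab) b.cast_nonneg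
    exact add_nonneg (add_nonneg (mul_nonneg (by positivity) (hF g hg))
      (mul_nonneg (sub_nonneg.2 hle) (hF g' hg'))) hk

theorem stateMean_one_sub (F : Goal → ℝ) (s : State) :
    stateMean (1 - F) 0 s = 1 - stateMean F 0 s := by
  rcases s with _ | ⟨⟨a, b⟩, g, g'⟩
  · rfl
  · simp only [stateMean, Pi.sub_apply, Pi.one_apply]
    ring

theorem stateMean_digit (F : Goal → ℝ) (k : ℝ) {a b : ℕ} (hb : b ≠ 0) (g g' : Goal) :
    1 / 2 * F (decided a b g g') +
        (1 - 1 / 2) * stateMean F k (.inr ((remainder a b, b), (g, g'))) =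
      stateMean F k (.inr ((a, b), (g, g'))) - k / 2 := by
  simp only [stateMean, decided, remainder]
  split_ifs with hab
  · push_cast [hab]
    field
  · push_cast
    field

/-- The walk of level `N` reaches `0` from `n`, if it is not stopped at `N + 1`, with probability
`base m p N ^ n`. -/
noncomputable def base (m : ℕ) (p : ℝ) (N : ℕ) : ℝ :=
  (1 - p) / p * ((m + 1) * N / (m * (N + 2)))

/-- The probability that a goal results in the bit `true`. -/
noncomputable def goalValue (m : ℕ) (p : ℝ) : Goal → ℝ
  | .inl b => if b then 1 else 0
  | .inr (N, n) => base m p N ^ n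

section Value

variable {m N : ℕ} {p : ℝ}

theorem base_nonneg (hp : 0 ≤ p) (hp1 : p ≤ 1) : 0 ≤ base m p N := by
  have := sub_nonneg.2 hp1
  unfold base
  positivity

theorem base_le_one (hm : 0 < m) (hp : 0 < p) (hpm : (1 - p) * (m + 1) ≤ p * m) :
    base m p N ≤ 1 := by
  have hN : (N : ℝ) ≤ N + 2 := by linarith
  rw [base, div_mul_div_comm, div_le_one (by positivity)]
  calc (1 - p) * ((m + 1) * N) = (1 - p) * (m + 1) * N := by ring
    _ ≤ p * m * (N + 2) := by gcongr
    _ = p * (m * (N + 2)) := by ring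

theorem base_two_mul (hm : 0 < m) : base m p (2 * m) = (1 - p) / p := by
  unfold base
  push_cast
  field

theorem base_eq_mul_base_succ :
    base m p N = N * (N + 3) / ((N + 1) * (N + 2)) * base m p (N + 1) := by
  unfold base
  push_cast
  field

theorem mul_base (hm : 0 < m) (hp : 0 < p) (hN : 0 < N) :
    p * (m * (N + 2) / ((m + 1) * N)) * base m p N = 1 - p := by
  unfold base
  field

theorem stateMean_goalValue_arrive (g : Goal) :
    stateMean (goalValue m p) 0 (arrive g) = goalValue m p g := by
  rcases g with b | ⟨N, n⟩
  · rfl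
  simp only [arrive]
  split_ifs with h0 hlt
  · simp [stateMean, goalValue, h0]
  · simp [stateMean, goalValue, base_eq_mul_base_succ (N := N), mul_pow, div_pow]
  · rfl

/-- With `x` the base and `u` the probability of not ignoring a step up, harmonicity at a site is
`p u x² + p (1 - u) x + (1 - p) = x`, a consequence of `p u x = 1 - p`. -/
theorem nextMean_goalValue (hm : 0 < m) (hp : 0 < p) {s : State} (hs : StateValid m s) :
    (algorithm m).nextMean p (stateMean (goalValue m p) 0) s = stateMean (goalValue m p) 0 s := by
  rcases s with (b | ⟨N, n⟩) | ⟨⟨a, b⟩, g, g'⟩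
  · rfl
  · obtain ⟨hN, hn, -⟩ := hs
    obtain ⟨n, rfl⟩ := Nat.exists_eq_succ_of_ne_zero hn
    change p * stateMean _ _ (.inr (_, (.inr (N, n + 1 + 1), .inr (N, n + 1)))) +
      (1 - p) * stateMean _ _ (arrive (.inr (N, n))) = base m p N ^ (n + 1)
    rw [stateMean_goalValue_arrive]
    simp only [stateMean, goalValue]
    push_cast
    linear_combination (base m p N ^ n * (base m p N - 1)) * mul_base hm hp (N := N) (by lia)
  · change 1 / 2 * stateMean _ _ (arrive _) + (1 - 1 / 2) * stateMean _ _ (.inr _) = _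
    rw [stateMean_goalValue_arrive, stateMean_digit _ _ hs.1, zero_div, sub_zero]

theorem stateMean_goalValue_mem_Icc (hm : 0 < m) (hp : 0 < p) (hp1 : p ≤ 1)
    (hpm : (1 - p) * (m + 1) ≤ p * m) {s : State} (hs : StateValid m s) :
    stateMean (goalValue m p) 0 s ∈ Set.Icc 0 1 := by
  have hval (g : Goal) : goalValue m p g ∈ Set.Icc 0 1 := by
    rcases g with (_ | _) | ⟨N, n⟩
    · simp [goalValue]
    · simp [goalValue]
    · exact ⟨pow_nonneg (base_nonneg hp.le hp1) n,
        pow_le_one₀ (base_nonneg hp.le hp1) (base_le_one hm hp hpm)⟩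
  refine ⟨stateMean_nonneg (fun g _ => (hval g).1) le_rfl hs, ?_⟩
  rw [← sub_nonneg, ← stateMean_one_sub]
  exact stateMean_nonneg (fun g _ => sub_nonneg.2 (hval g).2) le_rfl hs

theorem stateMean_goalValue_init (hm : 0 < m) (hp : 0 < p) :
    stateMean (goalValue m p) 0 (algorithm m).init = 1 / (2 * p) := by
  simp only [algorithm, stateMean, goalValue, base_two_mul hm]
  push_cast
  field

end Value

/-- A bound for the expected number of steps in pursuit of a goal. -/
def goalBound (K : ℝ) : Goal → ℝ
  | .inl _ => 0
  | .inr (N, n) => K * (4 * N - n)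

section Bound

variable {m N : ℕ} {p K : ℝ}

theorem goalBound_nonneg (hm : 0 < m) (hK : 0 ≤ K) {g : Goal} (hg : GoalValid m g) :
    0 ≤ goalBound K g := by
  rcases g with b | ⟨N, n⟩
  · exact le_rfl
  · obtain ⟨hN, hnN⟩ := hg
    have hn : n ≤ 4 * N := by lia
    exact mul_nonneg hK (sub_nonneg.2 (mod_cast hn))

theorem levelUp_prob_le (N : ℕ) :
    ((N * (N + 3) : ℝ) / ((N + 1) * (N + 2))) ^ (N + 1) ≤ (N + 2) / (N + 4) := by
  set t : ℝ := 2 / (N + 2)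
  have ht : t ≤ (N + 1 : ℕ) := by
    rw [div_le_iff₀ (by positivity)]
    push_cast
    nlinarith
  calc ((N * (N + 3) : ℝ) / ((N + 1) * (N + 2))) ^ (N + 1) = (1 - t / (N + 1 : ℕ)) ^ (N + 1) := by
        congr 1
        push_cast
        field
    _ ≤ Real.exp (-t) := Real.one_sub_div_pow_le_exp_neg ht
    _ = (Real.exp t)⁻¹ := Real.exp_neg t
    _ ≤ (t + 1)⁻¹ := by gcongr; exact Real.add_one_le_exp t
    _ = (N + 2) / (N + 4) := by field

theorem stateMean_goalBound_arrive_le (hm : 3 ≤ m) (hK : 10 ≤ K) {g : Goal} (hg : GoalValid m g) :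
    stateMean (goalBound K) 2 (arrive g) ≤ goalBound K g := by
  rcases g with b | ⟨N, n⟩
  · rfl
  obtain ⟨hN, hnN⟩ := hg
  have hN6 : (6 : ℝ) ≤ N := mod_cast (by lia : 6 ≤ N)
  simp only [arrive]
  split_ifs with h0 hlt
  · simp only [stateMean, goalBound, h0]
    push_cast
    nlinarith
  · obtain rfl : n = N + 1 := by lia
    have hgap : 2 ≤ K * (3 * N - 1 - 3 * (N + 1) * ((N + 2) / (N + 4))) := by
      have heq : (3 * N - 1 - 3 * (N + 1) * ((N + 2) / (N + 4)) : ℝ) = (2 * N - 10) / (N + 4) := by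
        field
      rw [heq, mul_div_assoc', le_div_iff₀ (by positivity)]
      nlinarith
    have hprob : K * (3 * (N + 1) * ((N * (N + 3) : ℝ) / ((N + 1) * (N + 2))) ^ (N + 1)) ≤
        K * (3 * (N + 1) * ((N + 2) / (N + 4))) := by
      gcongr
      exact levelUp_prob_le N
    simp only [stateMean, goalBound]
    push_cast
    rw [← div_pow]
    linarith
  · rfl

theorem nextMean_goalBound_add_one_le (hm : 3 ≤ m) (hp : 0 ≤ p) (hp1 : p ≤ 1) (hK : 10 ≤ K)
    (hdrift : 3 ≤ K * (p * (m / (m + 1)) - (1 - p))) {s : State} (hs : StateValid m s)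
    (hrun : (algorithm m).Running s) :
    (algorithm m).nextMean p (stateMean (goalBound K) 2) s + 1 ≤ stateMean (goalBound K) 2 s := by
  rcases s with (b | ⟨N, n⟩) | ⟨⟨a, b⟩, g, g'⟩
  · exact absurd rfl (hrun b)
  · obtain ⟨hN, hn, hnN⟩ := hs
    obtain ⟨n, rfl⟩ := Nat.exists_eq_succ_of_ne_zero hn
    have hN0 : (0 : ℝ) < N := mod_cast (by lia : 0 < N)
    have hdown : stateMean (goalBound K) 2 (arrive (.inr (N, n))) ≤ goalBound K (.inr (N, n)) :=
      stateMean_goalBound_arrive_le hm hK ⟨hN, by lia⟩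
    have hup : (m / (m + 1) : ℝ) ≤ m * (N + 2) / ((m + 1) * N) := by
      rw [mul_div_mul_comm]
      exact le_mul_of_one_le_right (by positivity) ((one_le_div hN0).2 (by linarith))
    change p * stateMean _ _ (.inr (_, (.inr (N, n + 1 + 1), .inr (N, n + 1)))) +
      (1 - p) * stateMean _ _ (arrive (.inr (N, n))) + 1 ≤ _
    calc _ ≤ p * stateMean (goalBound K) 2
            (.inr ((m * (N + 2), (m + 1) * N), (.inr (N, n + 1 + 1), .inr (N, n + 1)))) +
          (1 - p) * goalBound K (.inr (N, n)) + 1 := by gcongr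
      _ = K * (4 * N - (n + 1)) - K * (p * (m * (N + 2) / ((m + 1) * N)) - (1 - p)) + 2 * p +
          1 := by
        simp only [stateMean, goalBound]
        push_cast
        ring
      _ ≤ K * (4 * N - (n + 1)) - K * (p * (m / (m + 1)) - (1 - p)) + 2 * p + 1 := by gcongr
      _ ≤ K * (4 * N - (n + 1)) := by linarith
      _ = _ := by simp [stateMean, goalBound]
  · obtain ⟨hb, -, hg, hg'⟩ := hs
    have hdec : GoalValid m (decided a b g g') := by unfold decided; split_ifs <;> assumption
    have harrive := stateMean_goalBound_arrive_le hm hK hdec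
    have hdigit := stateMean_digit (goalBound K) 2 (a := a) hb g g'
    change 1 / 2 * stateMean _ _ (arrive _) + (1 - 1 / 2) * stateMean _ _ (.inr _) + 1 ≤ _
    linarith

end Bound

theorem algorithm_spec {m : ℕ} {p K : ℝ} (hm : 3 ≤ m) (hp : 0 < p) (hK : 10 ≤ K)
    (hdrift : 3 ≤ K * (p * (m / (m + 1)) - (1 - p)))
    {Ω : Type*} [MeasurableSpace Ω] {P : Measure Ω} {X U : ℕ → Ω → Bool}
    (h : IsCoinSource P p X U) :
    P {ω | (algorithm m).Returns (X · ω) (U · ω) true} = ENNReal.ofReal (1 / (2 * p)) ∧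
    P {ω | (algorithm m).Returns (X · ω) (U · ω) false} = ENNReal.ofReal (1 - 1 / (2 * p)) ∧
    ∫⁻ ω, ((algorithm m).numTrials (X · ω) (U · ω) : ℝ≥0∞) ∂P ≤
      ENNReal.ofReal (stateMean (goalBound K) 2 (algorithm m).init) := by
  have hm0 : 0 < m := by lia
  have hI := isInvariant_stateValid hm0
  have hpm : (1 - p) * (m + 1) ≤ p * m := by
    have hpos : 0 ≤ p * (m / (m + 1)) - (1 - p) := by
      by_contra! hneg
      nlinarith
    rw [← le_div_iff₀ (by positivity), mul_div_assoc]
    linarith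
  have hruntime := CoinAlgorithm.lintegral_runtime_le h hp.le hI
    (fun s hs => stateMean_nonneg (fun g hg => goalBound_nonneg hm0 (by linarith) hg)
      zero_le_two hs)
    (fun s hs hrun => nextMean_goalBound_add_one_le hm hp.le h.le_one hK hdrift hs hrun)
  obtain ⟨htrue, hfalse⟩ := CoinAlgorithm.measure_returns_eq h hp.le hI
    (ne_top_of_le_ne_top ENNReal.ofReal_ne_top hruntime)
    (fun s hs => stateMean_goalValue_mem_Icc hm0 hp h.le_one hpm hs)
    (fun s hs => nextMean_goalValue hm0 hp hs) (by
      rintro ((b | _) | _) _ - hact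
      · cases hact; rfl
      · cases hact
      · cases hact)
  rw [stateMean_goalValue_init hm0 hp] at htrue hfalse
  exact ⟨htrue, hfalse,
    (lintegral_mono fun ω => CoinAlgorithm.numTrials_le_runtime _ _).trans hruntime⟩

theorem exists_drift_pos {q : ℝ} (hq : 1 / 2 < q) :
    ∃ m : ℕ, 3 ≤ m ∧ 0 < q * (m / (m + 1)) - (1 - q) := by
  obtain ⟨n, hn⟩ := exists_nat_gt ((1 - q) / (2 * q - 1))
  rw [div_lt_iff₀ (by linarith)] at hn
  refine ⟨n + 3, by lia, ?_⟩
  rw [mul_div_assoc', sub_pos, lt_div_iff₀ (by positivity)]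
  push_cast
  nlinarith

end ReciprocalHalf

theorem corollary3p2_general {q : ℝ} (hq : 1 / 2 < q) :
    ∃ (A : CoinAlgorithm) (C : ℝ≥0), ∀ p : ℝ, q ≤ p →
      ∀ (Ω : Type*) [MeasurableSpace Ω] (P : Measure Ω) (X U : ℕ → Ω → Bool),
        IsCoinSource P p X U →
        P {ω | A.Returns (fun i => X i ω) (fun i => U i ω) true} = ENNReal.ofReal (1 / (2 * p)) ∧
        P {ω | A.Returns (fun i => X i ω) (fun i => U i ω) false} =
          ENNReal.ofReal (1 - 1 / (2 * p)) ∧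
        ∫⁻ ω, (A.numTrials (fun i => X i ω) (fun i => U i ω) : ℝ≥0∞) ∂P ≤ C := by
  obtain ⟨m, hm, hd⟩ := ReciprocalHalf.exists_drift_pos hq
  set d := q * (m / (m + 1)) - (1 - q)
  refine ⟨ReciprocalHalf.algorithm m, _, fun p hp Ω _ P X U h =>
    ReciprocalHalf.algorithm_spec (K := 10 + 3 / d) hm (by linarith)
      (le_add_of_nonneg_right (by positivity)) ?_ h⟩
  calc (3 : ℝ) = 3 / d * d := (div_mul_cancel₀ 3 hd.ne').symm
    _ ≤ (10 + 3 / d) * d := by gcongr; linarith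
    _ ≤ (10 + 3 / d) * (p * (m / (m + 1)) - (1 - p)) := by
      simp only [d]
      gcongr

theorem corollary3p2 :
    ∃ (A : CoinAlgorithm) (C : ℝ≥0), ∀ p : ℝ, 2 / 3 ≤ p → p ≤ 1 →
      ∀ (Ω : Type*) [MeasurableSpace Ω] (P : Measure Ω) [IsProbabilityMeasure P]
        (X U : ℕ → Ω → Bool), IsCoinSource P p X U →
        P {ω | A.Returns (fun i => X i ω) (fun i => U i ω) true} = ENNReal.ofReal (1 / (2 * p)) ∧
        P {ω | A.Returns (fun i => X i ω) (fun i => U i ω) false} =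
          ENNReal.ofReal (1 - 1 / (2 * p)) ∧
        ∫⁻ ω, (A.numTrials (fun i => X i ω) (fun i => U i ω) : ℝ≥0∞) ∂P ≤ C := by
  obtain ⟨A, C, hA⟩ := corollary3p2_general (q := 2 / 3) (by norm_num)
  exact ⟨A, C, fun p hp _ Ω _ P _ X U h => hA p hp Ω P X U h⟩
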